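/- **Setting.** Let $\theta>0$, $\varphi,\chi\in\mathbb R$, and let $d\ge 2$, $M\ge 1$ be integers with $d\theta\le \tfrac19$. In the basis $|0_\ell\rangle=|01\rangle$, $|1_\ell\rangle=|10\rangle$ put $$U=\begin{pmatrix}e^{-i\varphi}\cos\theta & -ie^{i\chi}\sin\theta\\ -ie^{-i\chi}\sin\theta & e^{i\varphi}\cos\theta\end{pmatrix},\qquad \mathcal U_j(\omega)=\big(e^{i\omega Z}U\big)^j ,$$ and let $p_{X,j}(\omega)=|\langle 0_\ell|\mathcal U_j(\omega)|{+_\ell}\rangle|^2$ and $p_{Y,j}(\omega)=|\langle 0_\ell|\mathcal U_j(\omega)|\mathrm i_\ell\rangle|^2$, where $|{+_\ell}\rangle=\tfrac1{\sqrt2}(|0_\ell\rangle+|1_\ell\rangle)$ and $|\mathrm i_\ell\rangle=\tfrac1{\sqrt2}(|0_\ell\rangle+i|1_\ell\rangle)$. Measuring with degree $j$ and angle $\omega$ means: perform $M$ independent Bernoulli trials with success probability $p_{X,j}(\omega)$ and $M$ independent ones with success probability $p_{Y,j}(\omega)$, with success frequencies $p_X^{\exp},p_Y^{\exp}$, and set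 $\mathfrak h^{\exp}=p_X^{\exp}-\tfrac12+i(p_Y^{\exp}-\tfrac12)$. For $x\in\mathbb R^n$ let $A_n(x)=\frac12\,\frac{\mathbb 1^\top \mathfrak D^{-1}x}{\mathbb 1^\top \mathfrak D^{-1}\mathbb 1}$, where $\mathbb 1=(1,\dots,1)^\top\in\mathbb R^n$ and $\mathfrak D$ is the $n\times n$ discrete Laplacian (diagonal entries $2$, entries next to the diagonal $-1$, all others $0$). *Stage 1 (QSPC-F estimator).* Measure independently with degree $d$ at the angles $\omega_j=\frac{j\pi}{2d-1}$, $0\le j\le 2d-2$, which gives $\mathfrak h_j^{\exp}$. Put $c_k^{\exp}=\frac1{2d-1}\sum_{j}e^{-2\pi i jk/(2d-1)}\mathfrak h^{\exp}_j$ for $0\le k\le d-1$, $\Delta_k=\arg\big(c_k^{\exp}\overline{c_{k+1}^{\exp}}\big)\in(-\pi,\pi]$ for $0\le k\le d-2$ (with $\arg 0=0$), and $\hat\varphi=A_{d-1}(\Delta)$. *Stage 2 (progressive difference estimator).* Given the Stage 1 data, measure independently with degrees $j=d,d+2,\dots,3d$, all at the angle $\omega=\hat\varphi$, which gives $\mathfrak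 h_{(j)}^{\exp}$. Put $\Gamma_k=|\mathfrak h_{(d+2k+2)}^{\exp}|-|\mathfrak h_{(d+2k)}^{\exp}|$ for $0\le k\le d-1$, and $\hat\theta_{\mathrm{pd}}=A_d(\Gamma)$. **Statement.** Suppose that the variance of the QSPC-F estimator is of its nominal size $\frac{3}{8d^4\theta^2M}$ in the following sense: $$\mathrm{Var}(\hat\varphi)+\big(\mathbb E\hat\varphi-\varphi\big)^2\;\le\;2\cdot\frac{3}{8d^4\theta^2M}$$ (for an unbiased $\hat\varphi$ this says that $\mathrm{Var}(\hat\varphi)$ is at most twice the nominal value). Then the bias of $\hat\theta_{\mathrm{pd}}$ satisfies $$\big|\mathbb E[\hat\theta_{\mathrm{pd}}]-\theta\big|\;\le\;\frac{39}{16\,d^2M\theta}+\frac{7d\theta}{M}+19\,(d\theta)^3 .$$ -/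

import Mathlib

open MeasureTheory ProbabilityTheory Matrix

noncomputable section

namespace QSPC

/-! ### The circuit on the single-excitation subspace, in the basis `|0_ℓ⟩ = |01⟩`, `|1_ℓ⟩ = |10⟩` -/

/-- The `Z`-phase modulation `e^{iωZ}`. -/
def zRot (ω : ℝ) : Matrix (Fin 2) (Fin 2) ℂ :=
  !![Complex.exp (Complex.I * ω), 0; 0, Complex.exp (-Complex.I * ω)]

/-- The FsimGate with swap angle `θ`, single-qubit phase `φ` and phase `χ`. -/
def fsim (θ φ χ : ℝ) : Matrix (Fin 2) (Fin 2) ℂ :=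
  !![Complex.exp (-Complex.I * φ) * (Real.cos θ : ℂ),
      -Complex.I * Complex.exp (Complex.I * χ) * (Real.sin θ : ℂ);
     -Complex.I * Complex.exp (-Complex.I * χ) * (Real.sin θ : ℂ),
      Complex.exp (Complex.I * φ) * (Real.cos θ : ℂ)]

/-- The periodic circuit `(e^{iωZ} U_Fsim(θ,φ,χ))^d` with `d` applications of the gate. -/
def circuit (d : ℕ) (ω θ φ χ : ℝ) : Matrix (Fin 2) (Fin 2) ℂ :=
  (zRot ω * fsim θ φ χ) ^ d

/-- The logical Bell state `|+_ℓ⟩`. -/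
def ketPlus : Fin 2 → ℂ := ![1 / (Real.sqrt 2 : ℂ), 1 / (Real.sqrt 2 : ℂ)]

/-- The logical Bell state `|i_ℓ⟩`. -/
def ketI : Fin 2 → ℂ := ![1 / (Real.sqrt 2 : ℂ), Complex.I / (Real.sqrt 2 : ℂ)]

/-- The probability `|⟨0_ℓ| U |ψ⟩|²` of the outcome `01` on the input state `ψ`. -/
def transProb (d : ℕ) (ω θ φ χ : ℝ) (ψ : Fin 2 → ℂ) : ℝ :=
  ‖(circuit d ω θ φ χ *ᵥ ψ) 0‖ ^ 2

theorem zRot_mem (ω : ℝ) : zRot ω ∈ Matrix.unitaryGroup (Fin 2) ℂ := by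
  rw [Matrix.mem_unitaryGroup_iff]
  ext i j
  fin_cases i <;> fin_cases j <;>
    simp [zRot, Matrix.mul_apply, Fin.sum_univ_two, Matrix.star_apply,
      ← Complex.exp_conj, ← Complex.exp_add]

theorem fsim_mem (θ φ χ : ℝ) : fsim θ φ χ ∈ Matrix.unitaryGroup (Fin 2) ℂ := by
  have h := Complex.sin_sq_add_cos_sq (θ : ℂ)
  have e (z : ℂ) : Complex.exp z * Complex.exp (-z) = 1 := by simp [← Complex.exp_add]
  rw [Matrix.mem_unitaryGroup_iff]
  ext i j
  fin_cases i <;> fin_cases j <;>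
    simp [fsim, Matrix.mul_apply, Fin.sum_univ_two, Matrix.star_apply,
      ← Complex.exp_conj, ← Complex.cos_conj, ← Complex.sin_conj]
  · linear_combination Complex.cos θ ^ 2 * e (Complex.I * φ) +
      Complex.sin θ ^ 2 * e (Complex.I * χ) * (-Complex.I ^ 2) + h -
      Complex.sin θ ^ 2 * Complex.I_sq
  · ring
  · ring
  · linear_combination Complex.cos θ ^ 2 * e (Complex.I * φ) +
      Complex.sin θ ^ 2 * e (Complex.I * χ) * (-Complex.I ^ 2) + h -
      Complex.sin θ ^ 2 * Complex.I_sq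

theorem circuit_mem (d : ℕ) (ω θ φ χ : ℝ) :
    circuit d ω θ φ χ ∈ Matrix.unitaryGroup (Fin 2) ℂ :=
  pow_mem (mul_mem (zRot_mem ω) (fsim_mem θ φ χ)) d

theorem transProb_nonneg (d : ℕ) (ω θ φ χ : ℝ) (ψ : Fin 2 → ℂ) :
    0 ≤ transProb d ω θ φ χ ψ := by
  unfold transProb; positivity

theorem transProb_le_one (d : ℕ) (ω θ φ χ : ℝ) {ψ : Fin 2 → ℂ}
    (hψ : ‖ψ 0‖ ^ 2 + ‖ψ 1‖ ^ 2 = 1) : transProb d ω θ φ χ ψ ≤ 1 := by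
  have h := congrFun (congrFun (Matrix.mem_unitaryGroup_iff.1 (circuit_mem d ω θ φ χ)) 0) 0
  simp only [Matrix.mul_apply, Fin.sum_univ_two, Matrix.star_apply, Matrix.one_apply_eq] at h
  set a := circuit d ω θ φ χ 0 0
  set b := circuit d ω θ φ χ 0 1
  have hab : ‖a‖ ^ 2 + ‖b‖ ^ 2 = 1 := by
    have h' : ((‖a‖ ^ 2 + ‖b‖ ^ 2 : ℝ) : ℂ) = 1 := by
      push_cast
      rw [← Complex.mul_conj', ← Complex.mul_conj']
      exact h
    exact_mod_cast h'
  have hle : ‖(circuit d ω θ φ χ *ᵥ ψ) 0‖ ≤ ‖a‖ * ‖ψ 0‖ + ‖b‖ * ‖ψ 1‖ := by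
    simp only [Matrix.mulVec, dotProduct, Fin.sum_univ_two]
    exact (norm_add_le _ _).trans (by rw [norm_mul, norm_mul])
  have h0 : 0 ≤ ‖(circuit d ω θ φ χ *ᵥ ψ) 0‖ := norm_nonneg _
  unfold transProb
  nlinarith [sq_nonneg (‖a‖ * ‖ψ 1‖ - ‖b‖ * ‖ψ 0‖)]

/-- `p_X`, as an element of `[0, 1]`. -/
def pX (d : ℕ) (ω θ φ χ : ℝ) : unitInterval :=
  ⟨transProb d ω θ φ χ ketPlus, transProb_nonneg _ _ _ _ _ _,
    transProb_le_one _ _ _ _ _ (by simp [ketPlus]; norm_num)⟩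

/-- `p_Y`, as an element of `[0, 1]`. -/
def pY (d : ℕ) (ω θ φ χ : ℝ) : unitInterval :=
  ⟨transProb d ω θ φ χ ketI, transProb_nonneg _ _ _ _ _ _,
    transProb_le_one _ _ _ _ _ (by simp [ketI]; norm_num)⟩

/-! ### Measurement records and their laws -/

/-- The `M` outcomes for the input `|+_ℓ⟩` and the `M` outcomes for the input `|i_ℓ⟩`;
`true` means that `01` was measured. -/
abbrev Shots (M : ℕ) : Type := (Fin M → Bool) × (Fin M → Bool)

/-- The law of the outcomes of the `2M` independent runs with degree `d` and angle `ω`. -/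
def shotsLaw (d M : ℕ) (ω θ φ χ : ℝ) : Measure (Shots M) :=
  (Measure.pi fun _ : Fin M => bernoulliMeasure true false (pX d ω θ φ χ)).prod
    (Measure.pi fun _ : Fin M => bernoulliMeasure true false (pY d ω θ φ χ))

instance (d M : ℕ) (ω θ φ χ : ℝ) : IsProbabilityMeasure (shotsLaw d M ω θ φ χ) := by
  unfold shotsLaw; infer_instance

/-- The relative frequency of the outcome `01`. -/
def freq {M : ℕ} (b : Fin M → Bool) : ℝ := (∑ m, if b m then (1 : ℝ) else 0) / M

/-- The measured value `h^exp = p_X^exp - 1/2 + i (p_Y^exp - 1/2)`. -/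
def hExp {M : ℕ} (s : Shots M) : ℂ :=
  ((freq s.1 - 1 / 2 : ℝ) : ℂ) + Complex.I * ((freq s.2 - 1 / 2 : ℝ) : ℂ)

/-! ### The weighted average with the discrete Laplacian -/

/-- The `n × n` discrete Laplacian. -/
def laplacian (n : ℕ) : Matrix (Fin n) (Fin n) ℝ :=
  Matrix.of fun i j =>
    if i = j then 2 else if i.val + 1 = j.val ∨ j.val + 1 = i.val then -1 else 0

/-- `½ (𝟙ᵀ D⁻¹ x) / (𝟙ᵀ D⁻¹ 𝟙)`. -/
def halfWeightedAverage {n : ℕ} (x : Fin n → ℝ) : ℝ :=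
  1 / 2 * (((fun _ => 1) ⬝ᵥ ((laplacian n)⁻¹ *ᵥ x)) /
    ((fun _ => 1) ⬝ᵥ ((laplacian n)⁻¹ *ᵥ (fun _ => 1))))

/-! ### First stage: the QSPC-F estimator of `φ` -/

/-- The outcomes of the circuits of degree `d` at the angles `ω_j = jπ/(2d-1)`, `0 ≤ j ≤ 2d-2`. -/
abbrev PriorRecord (d M : ℕ) : Type := Fin (2 * d - 1) → Shots M

/-- The law of the first-stage outcomes (all runs are independent). -/
def priorLaw (d M : ℕ) (θ φ χ : ℝ) : Measure (PriorRecord d M) :=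
  Measure.pi fun j => shotsLaw d M ((j.val : ℝ) * Real.pi / (2 * (d : ℝ) - 1)) θ φ χ

instance (d M : ℕ) (θ φ χ : ℝ) : IsProbabilityMeasure (priorLaw d M θ φ χ) := by
  unfold priorLaw; infer_instance

/-- The measured Fourier coefficient `c_k^exp`, `0 ≤ k ≤ d-1` (discrete Fourier transform). -/
def cExp {d M : ℕ} (r : PriorRecord d M) (k : ℕ) : ℂ :=
  1 / (2 * (d : ℂ) - 1) *
    ∑ j, Complex.exp (-(2 * Real.pi * Complex.I * j.val * k / (2 * (d : ℂ) - 1))) * hExp (r j)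

/-- The sequential phase differences `Δ_k`, `0 ≤ k ≤ d-2`, with values in `(-π, π]`. -/
def phaseDiff {d M : ℕ} (r : PriorRecord d M) (k : Fin (d - 1)) : ℝ :=
  Complex.arg (cExp r k.val * (starRingEnd ℂ) (cExp r (k.val + 1)))

/-- The QSPC-F estimator `φ̂`. -/
def phiHat {d M : ℕ} (r : PriorRecord d M) : ℝ := halfWeightedAverage (phaseDiff r)

/-! ### Second stage: the progressive difference estimator of `θ` -/

/-- The outcomes of the circuits of degrees `d, d+2, …, 3d`; index `k` belongs to `d + 2k`. -/
abbrev PdRecord (d M : ℕ) : Type := Fin (d + 1) → Shots M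

/-- The law of the second-stage outcomes when all circuits are run at the angle `ω`. -/
def pdLaw (d M : ℕ) (ω θ φ χ : ℝ) : Measure (PdRecord d M) :=
  Measure.pi fun k => shotsLaw (d + 2 * k.val) M ω θ φ χ

instance (d M : ℕ) (ω θ φ χ : ℝ) : IsProbabilityMeasure (pdLaw d M ω θ φ χ) := by
  unfold pdLaw; infer_instance

/-- The differential signal `Γ_k = |h^exp_{d+2(k+1)}| - |h^exp_{d+2k}|`, `0 ≤ k ≤ d-1`. -/
def diffSignal {d M : ℕ} (s : PdRecord d M) (k : Fin d) : ℝ :=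
  ‖hExp (s k.succ)‖ - ‖hExp (s k.castSucc)‖

/-- The estimator `θ̂_pd`. -/
def thetaPd {d M : ℕ} (s : PdRecord d M) : ℝ := halfWeightedAverage (diffSignal s)

/-- The conditional law of the second stage, run at `ω = φ̂`, given the first-stage record. -/
def pdKernel (d M : ℕ) (θ φ χ : ℝ) : Kernel (PriorRecord d M) (PdRecord d M) :=
  Kernel.ofFunOfCountable fun r => pdLaw d M (phiHat r) θ φ χ

instance (d M : ℕ) (θ φ χ : ℝ) : IsMarkovKernel (pdKernel d M θ φ χ) :=
  ⟨fun r => inferInstanceAs (IsProbabilityMeasure (pdLaw d M (phiHat r) θ φ χ))⟩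

/-- The joint law of both stages of the experiment. -/
def experimentLaw (d M : ℕ) (θ φ χ : ℝ) : Measure (PriorRecord d M × PdRecord d M) :=
  priorLaw d M θ φ χ ⊗ₘ pdKernel d M θ φ χ

/-- The bias `E[θ̂_pd] - θ` when the QSPC-F estimator is used as the prior phase. -/
def biasPd (d M : ℕ) (θ φ χ : ℝ) : ℝ :=
  (∫ z, thetaPd z.2 ∂(experimentLaw d M θ φ χ)) - θ

/-- The bias `E[φ̂] - φ` of the QSPC-F estimator. -/
def biasPhi (d M : ℕ) (θ φ χ : ℝ) : ℝ :=
  (∫ r, phiHat r ∂(priorLaw d M θ φ χ)) - φ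

end QSPC

end

/-!
By the discrete parabola `D⁻¹ 𝟙` and summation by parts, the estimator `θ̂_pd` is the
least-squares slope, in the degree, of the measured amplitudes `|h_j|`, `j = d, d + 2, …, 3d`
(`thetaPd_eq`). Since this functional returns `θ` on the exactly linear amplitudes `j θ`, it suffices
to compare the expected amplitudes with `j θ`.

Let `δ = φ̂ - φ`. The exact amplitude is `|b| √(1 - |b|²)` with `|b| = sin θ |U_{j-1}(x)|` and
`x = cos θ cos δ`. As `j - U_{j-1}(x) ≤ j (j² - 1) / 3 · (1 - x)` and `|U_{j-1}(x)| ≤ j` on all of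
`[-1, 1]`, the amplitude lies between `j θ - (θ δ² / 6 + 7 θ³ / 6) j³` and `j θ`, whatever `δ` is
(`norm_hExact_bounds`). Shot noise can only raise the expected amplitude, by convexity of the norm,
and the expectation stays below `j θ + 1 / (4 M j θ)`, by the inequality
`|z| ≤ (|z|² + B²) / (2 B)` with `B = j θ` and the variance bound `1 / (4 M)` of a relative
frequency (`integral_norm_hExp_bounds`).

The regression weights are `2k - d = (k² - (d - k)²) / d`, so polynomial sums bound the slope error
(`abs_slope_sub_le`) for a fixed `δ`. The result is affine in `δ²`; averaging over the first stage
turns `δ²` into the mean squared error of `φ̂`, which is its variance plus its squared bias.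
-/

noncomputable section
namespace QSPC
open Polynomial

/-! ### Chebyshev polynomials of the second kind near their maximum -/

theorem abs_sin_nat_mul_le (n : ℕ) (x : ℝ) : |Real.sin (n * x)| ≤ n * |Real.sin x| := by
  induction n with
  | zero => simp
  | succ n ih =>
    have e : ((n + 1 : ℕ) : ℝ) * x = n * x + x := by push_cast; ring
    rw [e, Real.sin_add]
    calc |Real.sin (n * x) * Real.cos x + Real.cos (n * x) * Real.sin x|
        ≤ |Real.sin (n * x)| * |Real.cos x| + |Real.cos (n * x)| * |Real.sin x| := by
          rw [← abs_mul, ← abs_mul]; exact abs_add_le _ _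
      _ ≤ |Real.sin (n * x)| * 1 + 1 * |Real.sin x| := by
          gcongr
          · exact Real.abs_cos_le_one x
          · exact Real.abs_cos_le_one _
      _ ≤ ((n + 1 : ℕ) : ℝ) * |Real.sin x| := by push_cast; linarith

theorem one_sub_cos_nat_mul_le (n : ℕ) (x : ℝ) :
    1 - Real.cos (n * x) ≤ n ^ 2 * (1 - Real.cos x) := by
  have h (y : ℝ) : 1 - Real.cos y = 2 * |Real.sin (y / 2)| ^ 2 := by
    rw [sq_abs, Real.sin_sq_eq_half_sub]; ring_nf
  have hs := abs_sin_nat_mul_le n (x / 2)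
  rw [h, h, mul_div_assoc]
  calc 2 * |Real.sin (n * (x / 2))| ^ 2 ≤ 2 * (n * |Real.sin (x / 2)|) ^ 2 := by gcongr
    _ = _ := by ring

/-- The recurrence `U_{n+1} = U_{n-1} + 2 T_{n+1}` at `cos σ`. -/
theorem eval_U_cos_add_two (n : ℕ) (σ : ℝ) :
    (Chebyshev.U ℝ (((n + 2 : ℕ) : ℤ) - 1)).eval (Real.cos σ) =
      (Chebyshev.U ℝ ((n : ℤ) - 1)).eval (Real.cos σ) + 2 * Real.cos (((n + 1 : ℕ) : ℝ) * σ) := by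
  have e : (((n + 2 : ℕ) : ℤ) - 1) = ((n : ℤ) - 1) + 2 := by push_cast; ring
  have e' : ((n : ℤ) - 1) + 2 = ((n + 1 : ℕ) : ℤ) := by push_cast; ring
  rw [e, Chebyshev.U_eq_two_mul_T_add_U, e', eval_add, eval_mul, Chebyshev.T_real_cos]
  simp
  ring

theorem abs_eval_U_cos_le (σ : ℝ) (n : ℕ) :
    |(Chebyshev.U ℝ ((n : ℤ) - 1)).eval (Real.cos σ)| ≤ n := by
  induction n using Nat.twoStepInduction with
  | zero => simp
  | one => simp
  | more n ih _ =>
    rw [eval_U_cos_add_two]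
    refine (abs_add_le _ _).trans ?_
    rw [abs_mul, abs_two]
    have := Real.abs_cos_le_one (((n + 1 : ℕ) : ℝ) * σ)
    push_cast at *
    linarith

/-- The deviation of `U_{n-1}` from its maximum `n = U_{n-1}(1)` is controlled by the slope of
`U_{n-1}` at `1`, on all of `[-1, 1]`. -/
theorem sub_eval_U_cos_le (σ : ℝ) (n : ℕ) :
    n - (Chebyshev.U ℝ ((n : ℤ) - 1)).eval (Real.cos σ) ≤
      n * (n ^ 2 - 1) / 3 * (1 - Real.cos σ) := by
  induction n using Nat.twoStepInduction with
  | zero => simp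
  | one => simp
  | more n ih _ =>
    rw [eval_U_cos_add_two]
    have := one_sub_cos_nat_mul_le (n + 1) σ
    push_cast at *
    linarith

/-! ### The exact signal -/

/-- Cayley–Hamilton for a `2 × 2` matrix of determinant one: the off-diagonal entry of the `n`-th
power is `U_{n-1}`, taken at half the trace, times the off-diagonal entry. -/
theorem pow_apply_zero_one (W : Matrix (Fin 2) (Fin 2) ℂ) (x : ℂ) (htr : W 0 0 + W 1 1 = 2 * x)
    (hdet : W 0 0 * W 1 1 - W 0 1 * W 1 0 = 1) (n : ℕ) :
    (W ^ n) 0 1 = (Chebyshev.U ℂ ((n : ℤ) - 1)).eval x * W 0 1 := by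
  have hsq : W ^ 2 = (2 * x) • W - 1 := by
    rw [← htr]
    ext i j
    fin_cases i <;> fin_cases j <;>
      simp [pow_two, Matrix.mul_apply, Fin.sum_univ_two, Matrix.sub_apply]
    · linear_combination -hdet
    · ring
    · ring
    · linear_combination -hdet
  induction n using Nat.twoStepInduction with
  | zero => simp
  | one => simp
  | more n ih ih' =>
    have e : (((n + 2 : ℕ) : ℤ) - 1) = ((n : ℤ) - 1) + 2 := by push_cast; ring
    have e' : (((n + 1 : ℕ) : ℤ) - 1) = ((n : ℤ) - 1) + 1 := by push_cast; ring
    rw [e'] at ih'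
    have : W ^ (n + 2) = (2 * x) • W ^ (n + 1) - W ^ n := by
      rw [pow_add, hsq, mul_sub, mul_one, Matrix.mul_smul, pow_succ]
    rw [this, Matrix.sub_apply, Matrix.smul_apply, ih, ih', e, Chebyshev.U_add_two]
    simp
    ring

/-- One step `e^{iωZ} U` of the circuit has determinant one and trace `2 cos θ cos (ω - φ)`; the
angle `σ` is its rotation angle. -/
theorem norm_circuit_zero_one (n : ℕ) (ω θ φ χ σ : ℝ)
    (hσ : Real.cos σ = Real.cos θ * Real.cos (ω - φ)) :
    ‖circuit n ω θ φ χ 0 1‖ =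
      |(Chebyshev.U ℝ ((n : ℤ) - 1)).eval (Real.cos σ)| * |Real.sin θ| := by
  have e1 : Complex.exp (Complex.I * ω) * Complex.exp (-Complex.I * φ)
      = Complex.cos ((ω - φ : ℝ)) + Complex.sin ((ω - φ : ℝ)) * Complex.I := by
    rw [← Complex.exp_mul_I, ← Complex.exp_add]; push_cast; ring_nf
  have e2 : Complex.exp (-Complex.I * ω) * Complex.exp (Complex.I * φ)
      = Complex.cos ((ω - φ : ℝ)) - Complex.sin ((ω - φ : ℝ)) * Complex.I := by
    rw [sub_eq_add_neg, ← neg_mul, ← Complex.sin_neg, ← Complex.cos_neg, ← Complex.exp_mul_I,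
      ← Complex.exp_add]; push_cast; ring_nf
  have e3 : Complex.exp (Complex.I * ω) * Complex.exp (-Complex.I * ω) = 1 := by
    rw [← Complex.exp_add]; simp
  have e4 : Complex.exp (Complex.I * χ) * Complex.exp (-Complex.I * χ) = 1 := by
    rw [← Complex.exp_add]; simp
  have e5 : Complex.exp (Complex.I * φ) * Complex.exp (-Complex.I * φ) = 1 := by
    rw [← Complex.exp_add]; simp
  have hs := Complex.sin_sq_add_cos_sq (θ : ℂ)
  have h00 : (zRot ω * fsim θ φ χ) 0 0 =
      Complex.exp (Complex.I * ω) * (Complex.exp (-Complex.I * φ) * Complex.cos θ) := by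
    simp [zRot, fsim, Matrix.mul_apply, Fin.sum_univ_two]
  have h11 : (zRot ω * fsim θ φ χ) 1 1 =
      Complex.exp (-Complex.I * ω) * (Complex.exp (Complex.I * φ) * Complex.cos θ) := by
    simp [zRot, fsim, Matrix.mul_apply, Fin.sum_univ_two]
  have h01 : (zRot ω * fsim θ φ χ) 0 1 =
      Complex.exp (Complex.I * ω) * (-Complex.I * Complex.exp (Complex.I * χ) * Complex.sin θ) := by
    simp [zRot, fsim, Matrix.mul_apply, Fin.sum_univ_two]
  have h10 : (zRot ω * fsim θ φ χ) 1 0 =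
      Complex.exp (-Complex.I * ω) *
        (-Complex.I * Complex.exp (-Complex.I * χ) * Complex.sin θ) := by
    simp [zRot, fsim, Matrix.mul_apply, Fin.sum_univ_two]
  unfold circuit
  rw [pow_apply_zero_one _ ((Real.cos σ : ℝ) : ℂ), h01, norm_mul,
    ← Chebyshev.complex_ofReal_eval_U, Complex.norm_real, Real.norm_eq_abs]
  · have n1 (y : ℝ) : ‖Complex.exp (Complex.I * y)‖ = 1 := by
      rw [mul_comm, Complex.norm_exp_ofReal_mul_I]
    rw [norm_mul, norm_mul, norm_mul, n1, n1, ← Complex.ofReal_sin, Complex.norm_real]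
    simp
  · rw [h00, h11, hσ]
    push_cast at *
    linear_combination Complex.cos θ * (e1 + e2)
  · rw [h00, h11, h01, h10]
    generalize Complex.exp (Complex.I * ω) = a at *
    generalize Complex.exp (-Complex.I * ω) = a' at *
    generalize Complex.exp (Complex.I * φ) = b at *
    generalize Complex.exp (-Complex.I * φ) = b' at *
    generalize Complex.exp (Complex.I * χ) = c at *
    generalize Complex.exp (-Complex.I * χ) = c' at *
    linear_combination (Complex.cos θ ^ 2 * b * b' - Complex.I ^ 2 * Complex.sin θ ^ 2 * c * c') * e3
      + Complex.cos θ ^ 2 * e5 - Complex.I ^ 2 * Complex.sin θ ^ 2 * e4 + hs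
      - Complex.sin θ ^ 2 * Complex.I_sq

/-- The exact value of the measured quantity `h`. -/
def hExact (n : ℕ) (ω θ φ χ : ℝ) : ℂ :=
  (((pX n ω θ φ χ : ℝ) - 1 / 2 : ℝ) : ℂ) + Complex.I * (((pY n ω θ φ χ : ℝ) - 1 / 2 : ℝ) : ℂ)

theorem circuit_row_norm_sq (n : ℕ) (ω θ φ χ : ℝ) :
    ‖circuit n ω θ φ χ 0 0‖ ^ 2 + ‖circuit n ω θ φ χ 0 1‖ ^ 2 = 1 := by
  have h := congrFun (congrFun (Matrix.mem_unitaryGroup_iff.1 (circuit_mem n ω θ φ χ)) 0) 0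
  simp only [Matrix.mul_apply, Fin.sum_univ_two, Matrix.star_apply, Matrix.one_apply_eq] at h
  have h' : ((‖circuit n ω θ φ χ 0 0‖ ^ 2 + ‖circuit n ω θ φ χ 0 1‖ ^ 2 : ℝ) : ℂ) = 1 := by
    push_cast
    rw [← Complex.mul_conj', ← Complex.mul_conj']
    exact h
  exact_mod_cast h'

/-- The two input states read off the real and the imaginary part of the product of the entries of
the first row of the circuit. -/
theorem hExact_eq (n : ℕ) (ω θ φ χ : ℝ) :
    hExact n ω θ φ χ =
      circuit n ω θ φ χ 0 0 * (starRingEnd ℂ) (circuit n ω θ φ χ 0 1) := by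
  have hrow := circuit_row_norm_sq n ω θ φ χ
  unfold hExact pX pY transProb
  simp only [Matrix.mulVec, dotProduct, Fin.sum_univ_two, ketPlus, ketI]
  generalize circuit n ω θ φ χ 0 0 = a at *
  generalize circuit n ω θ φ χ 0 1 = b at *
  have h2 : (1 / (Real.sqrt 2 : ℂ)) = ((1 / Real.sqrt 2 : ℝ) : ℂ) := by push_cast; rfl
  have h3 : (Complex.I / (Real.sqrt 2 : ℂ)) = ((1 / Real.sqrt 2 : ℝ) : ℂ) * Complex.I := by
    push_cast; ring
  have hr : (1 / Real.sqrt 2) ^ 2 = 1 / 2 := by simp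
  rw [h2, h3]
  simp only [Matrix.cons_val_zero, Matrix.cons_val_one]
  generalize 1 / Real.sqrt 2 = r at *
  simp only [← Complex.normSq_eq_norm_sq, Complex.normSq_apply] at *
  apply Complex.ext
  · simp
    linear_combination hr * ((a.re + b.re) ^ 2 + (a.im + b.im) ^ 2) + hrow / 2
  · simp
    linear_combination hr * ((a.re - b.im) ^ 2 + (a.im + b.re) ^ 2) + hrow / 2

theorem one_sub_cos_mul_cos_le (x y : ℝ) : 1 - Real.cos x * Real.cos y ≤ (x ^ 2 + y ^ 2) / 2 := by
  have h1 := Real.one_sub_sq_div_two_le_cos (x := x)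
  have h2 := Real.one_sub_sq_div_two_le_cos (x := y)
  nlinarith [Real.cos_le_one x, Real.cos_le_one y,
    mul_nonneg (sub_nonneg.2 (Real.cos_le_one x)) (sub_nonneg.2 (Real.cos_le_one y))]

/-- The signal is linear in the degree up to a cubic loss, for every modulation angle. With the first
row `(a, b)` of the circuit, `|h| = |a||b|`, where `|b| = sin θ |U_{n-1}(cos θ cos (ω - φ))|`. -/
theorem norm_hExact_bounds (n : ℕ) (hn : 1 ≤ n) (ω θ φ χ : ℝ) (hθ : 0 < θ) (hθ1 : θ ≤ 1) :
    ‖hExact n ω θ φ χ‖ ≤ n * θ ∧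
      n * θ - (θ * (ω - φ) ^ 2 / 6 + 7 / 6 * θ ^ 3) * n ^ 3 ≤ ‖hExact n ω θ φ χ‖ := by
  have hrow := circuit_row_norm_sq n ω θ φ χ
  obtain ⟨σ, hσ⟩ : ∃ σ, Real.cos σ = Real.cos θ * Real.cos (ω - φ) := by
    have h : |Real.cos θ * Real.cos (ω - φ)| ≤ 1 := by
      rw [abs_mul]
      exact mul_le_one₀ (Real.abs_cos_le_one _) (abs_nonneg _) (Real.abs_cos_le_one _)
    exact ⟨_, Real.cos_arccos (abs_le.1 h).1 (abs_le.1 h).2⟩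
  have hsinpos : 0 < Real.sin θ := Real.sin_pos_of_pos_of_lt_pi hθ (by linarith [Real.pi_gt_three])
  have hsin := Real.sin_lt hθ
  have hsin' := Real.sin_gt_sub_cube hθ
  have hb := norm_circuit_zero_one n ω θ φ χ σ hσ
  have hD := abs_eval_U_cos_le σ n
  have hD' := sub_eval_U_cos_le σ n
  have hx := one_sub_cos_mul_cos_le θ (ω - φ)
  rw [← hσ] at hx
  have hn1 : (1 : ℝ) ≤ n := by exact_mod_cast hn
  rw [hExact_eq, norm_mul, RCLike.norm_conj]
  rw [abs_of_pos hsinpos] at hb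
  have hDa := le_abs_self ((Chebyshev.U ℝ ((n : ℤ) - 1)).eval (Real.cos σ))
  have hD0 := abs_nonneg ((Chebyshev.U ℝ ((n : ℤ) - 1)).eval (Real.cos σ))
  generalize |(Chebyshev.U ℝ ((n : ℤ) - 1)).eval (Real.cos σ)| = D at *
  generalize (Chebyshev.U ℝ ((n : ℤ) - 1)).eval (Real.cos σ) = D' at *
  have ha0 := norm_nonneg (circuit n ω θ φ χ 0 0)
  have hb0 := norm_nonneg (circuit n ω θ φ χ 0 1)
  generalize ‖circuit n ω θ φ χ 0 0‖ = a at *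
  generalize ‖circuit n ω θ φ χ 0 1‖ = b at *
  generalize Real.sin θ = s at *
  have hbn : b ≤ n * θ := by
    rw [hb]; exact mul_le_mul hD hsin.le hsinpos.le (by positivity)
  have ha1 : a ≤ 1 := by nlinarith
  have hDlow : n - n * (n ^ 2 - 1) / 6 * (θ ^ 2 + (ω - φ) ^ 2) ≤ D := by
    have : (n : ℝ) * (n ^ 2 - 1) / 3 * (1 - Real.cos σ) ≤
        n * (n ^ 2 - 1) / 3 * ((θ ^ 2 + (ω - φ) ^ 2) / 2) := by
      apply mul_le_mul_of_nonneg_left hx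
      have : (0 : ℝ) ≤ n ^ 2 - 1 := by nlinarith
      positivity
    linarith
  constructor
  · nlinarith
  · have h1 : b - b ^ 3 ≤ a * b := by
      -- `a = √(1 - b²) ≥ 1 - b²`
      have : a ^ 2 ≤ a := by nlinarith
      nlinarith
    have h2 : b ^ 3 ≤ (n * θ) ^ 3 := by gcongr
    have h3 : n * θ - n * (n ^ 2 - 1) / 6 * (θ ^ 2 + (ω - φ) ^ 2) * θ - n * (θ ^ 3 / 6) ≤ b := by
      have k1 : D * (θ - θ ^ 3 / 6) ≤ b := by rw [hb]; gcongr
      have k2 : D * (θ ^ 3 / 6) ≤ n * (θ ^ 3 / 6) := by gcongr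
      have k3 := mul_le_mul_of_nonneg_right hDlow hθ.le
      linarith
    have h4 : 0 ≤ n / 6 * (ω - φ) ^ 2 * θ := by positivity
    linarith

/-! ### Shot noise -/

theorem freq_eq_sum {M : ℕ} (b : Fin M → Bool) :
    freq b = (∑ m, fun c : Fin M → Bool => (if c m then (1 : ℝ) else 0)) b / M := by
  simp [freq]

theorem integral_freq {M : ℕ} (hM : 1 ≤ M) (p : unitInterval) :
    ∫ b, freq b ∂(Measure.pi fun _ : Fin M => bernoulliMeasure true false p) = p := by
  have h (m : Fin M) : ∫ b : Fin M → Bool, (if b m then (1 : ℝ) else 0)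
      ∂(Measure.pi fun _ : Fin M => bernoulliMeasure true false p) = p := by
    rw [integral_comp_eval (μ := fun _ : Fin M => bernoulliMeasure true false p) (i := m)
      (f := fun x : Bool => if x then (1 : ℝ) else 0) .of_discrete, integral_bernoulliMeasure]
    simp
  unfold freq
  rw [integral_div, integral_finsetSum _ fun _ _ => .of_finite]
  simp only [h]
  have : (M : ℝ) ≠ 0 := by positivity
  simp [this]

theorem variance_freq_le {M : ℕ} (hM : 1 ≤ M) (p : unitInterval) :
    Var[freq; Measure.pi fun _ : Fin M => bernoulliMeasure true false p] ≤ 1 / (4 * M) := by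
  have hM0 : (0 : ℝ) < M := by exact_mod_cast hM
  have h1 : Var[fun x : Bool => if x then (1 : ℝ) else 0; bernoulliMeasure true false p]
      ≤ 1 / 4 := by
    refine (variance_le_sq_of_bounded (a := 0) (b := 1) (.of_forall fun x => ?_)
      .of_discrete).trans (by norm_num)
    cases x <;> simp
  have e : (freq : (Fin M → Bool) → ℝ) = fun b =>
      (M : ℝ)⁻¹ * (∑ m, fun c : Fin M → Bool => (if c m then (1 : ℝ) else 0)) b := by
    funext b
    rw [freq_eq_sum, div_eq_inv_mul]
  rw [e, variance_const_mul,
    variance_sum_pi (X := fun (_ : Fin M) (x : Bool) => if x then (1 : ℝ) else 0)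
      fun _ => .of_discrete]
  rw [Finset.sum_const, Finset.card_univ, Fintype.card_fin, nsmul_eq_mul]
  calc _ ≤ ((M : ℝ)⁻¹) ^ 2 * (M * (1 / 4)) := by gcongr
    _ = 1 / (4 * M) := by field_simp

/-- The second moment of a relative frequency about any centre `c`, from the bias-variance
decomposition. -/
theorem integral_freq_sub_sq_le {M : ℕ} (hM : 1 ≤ M) (p : unitInterval) (c : ℝ) :
    ∫ b, (freq b - c) ^ 2 ∂(Measure.pi fun _ : Fin M => bernoulliMeasure true false p) ≤
      (p - c) ^ 2 + 1 / (4 * M) := by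
  have hv := variance_freq_le hM p
  have hm := integral_freq hM p
  have hs := variance_eq_sub (μ := Measure.pi fun _ : Fin M => bernoulliMeasure true false p)
    (X := fun b => freq b - c) .of_discrete
  rw [variance_sub_const .of_discrete] at hs
  have h1 : ∫ b, (freq b - c) ∂(Measure.pi fun _ : Fin M => bernoulliMeasure true false p) =
      p - c := by
    rw [integral_sub .of_finite .of_finite, hm]; simp
  rw [h1] at hs
  simp only [Pi.pow_apply] at hs
  linarith

theorem integral_hExp {M : ℕ} (hM : 1 ≤ M) (n : ℕ) (ω θ φ χ : ℝ) :
    ∫ s, hExp s ∂(shotsLaw n M ω θ φ χ) = hExact n ω θ φ χ := by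
  unfold hExp hExact shotsLaw
  rw [integral_add .of_finite .of_finite, integral_const_mul, integral_complex_ofReal,
    integral_complex_ofReal, integral_fun_fst (fun b : Fin M → Bool => freq b - 1 / 2),
    integral_fun_snd (fun b : Fin M → Bool => freq b - 1 / 2),
    integral_sub .of_finite .of_finite, integral_sub .of_finite .of_finite,
    integral_freq hM, integral_freq hM]
  simp

theorem integral_norm_hExp_sq_le {M : ℕ} (hM : 1 ≤ M) (n : ℕ) (ω θ φ χ : ℝ) :
    ∫ s, ‖hExp s‖ ^ 2 ∂(shotsLaw n M ω θ φ χ) ≤ ‖hExact n ω θ φ χ‖ ^ 2 + 1 / (2 * M) := by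
  have e (s : Shots M) : ‖hExp s‖ ^ 2 = (freq s.1 - 1 / 2) ^ 2 + (freq s.2 - 1 / 2) ^ 2 := by
    rw [← Complex.normSq_eq_norm_sq, Complex.normSq_apply]
    simp [hExp]
    ring
  have e' : ‖hExact n ω θ φ χ‖ ^ 2 =
      ((pX n ω θ φ χ : ℝ) - 1 / 2) ^ 2 + ((pY n ω θ φ χ : ℝ) - 1 / 2) ^ 2 := by
    rw [← Complex.normSq_eq_norm_sq, Complex.normSq_apply]
    simp [hExact]
    ring
  simp only [e, e']
  unfold shotsLaw
  rw [integral_add .of_finite .of_finite,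
    integral_fun_fst (fun b : Fin M → Bool => (freq b - 1 / 2) ^ 2),
    integral_fun_snd (fun b : Fin M → Bool => (freq b - 1 / 2) ^ 2)]
  have h1 := integral_freq_sub_sq_le hM (pX n ω θ φ χ) (1 / 2)
  have h2 := integral_freq_sub_sq_le hM (pY n ω θ φ χ) (1 / 2)
  have h3 : (1 : ℝ) / (2 * M) = 1 / (4 * M) + 1 / (4 * M) := by ring
  simp only [probReal_univ, one_smul]
  linarith

/-- The expected measured amplitude is `nθ` up to `1/(4Mnθ)` from above (shot noise) and up to a
loss of order `n³` from below (phase mismatch and nonlinearity), for every modulation angle. -/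
theorem integral_norm_hExp_bounds {M : ℕ} (hM : 1 ≤ M) (n : ℕ) (hn : 1 ≤ n) (ω θ φ χ : ℝ)
    (hθ : 0 < θ) (hθ1 : θ ≤ 1) :
    n * θ - (θ * (ω - φ) ^ 2 / 6 + 7 / 6 * θ ^ 3) * n ^ 3 ≤
        ∫ s, ‖hExp s‖ ∂(shotsLaw n M ω θ φ χ) ∧
      ∫ s, ‖hExp s‖ ∂(shotsLaw n M ω θ φ χ) ≤ n * θ + 1 / (4 * M * (n * θ)) := by
  obtain ⟨hu, hl⟩ := norm_hExact_bounds n hn ω θ φ χ hθ hθ1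
  have hn0 : (0 : ℝ) < n := by exact_mod_cast hn
  have hB : 0 < (n : ℝ) * θ := by positivity
  have hM0 : (0 : ℝ) < M := by exact_mod_cast hM
  constructor
  · refine hl.trans ?_
    rw [← integral_hExp hM]
    exact norm_integral_le_integral_norm _
  · set B := (n : ℝ) * θ
    have h2 := integral_norm_hExp_sq_le hM n ω θ φ χ
    -- arithmetic-geometric mean inequality with the reference amplitude `B`
    calc ∫ s, ‖hExp s‖ ∂(shotsLaw n M ω θ φ χ)
        ≤ ∫ s, (‖hExp s‖ ^ 2 + B ^ 2) / (2 * B) ∂(shotsLaw n M ω θ φ χ) := by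
          refine integral_mono .of_finite .of_finite fun s => ?_
          dsimp only
          rw [le_div_iff₀ (by positivity)]
          nlinarith [sq_nonneg (‖hExp s‖ - B)]
      _ = (∫ s, ‖hExp s‖ ^ 2 ∂(shotsLaw n M ω θ φ χ) + B ^ 2) / (2 * B) := by
          rw [integral_div, integral_add .of_finite .of_finite]; simp
      _ ≤ (B ^ 2 + 1 / (2 * M) + B ^ 2) / (2 * B) := by
          have : ‖hExact n ω θ φ χ‖ ^ 2 ≤ B ^ 2 := by gcongr
          gcongr
          linarith
      _ = B + 1 / (4 * M * B) := by field_simp; ring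

/-! ### The Laplacian average as a regression slope -/

/-- The Laplacian acts as the negated second difference on vectors extended by zero. -/
theorem laplacian_mulVec (n : ℕ) (f : ℕ → ℝ) (h0 : f 0 = 0) (hn : f (n + 1) = 0) (i : Fin n) :
    (laplacian n *ᵥ fun j => f (j.val + 1)) i = 2 * f (i.val + 1) - f i.val - f (i.val + 2) := by
  have hsplit (j : Fin n) : laplacian n i j * f (j.val + 1) =
      (if j.val = i.val then 2 * f (i.val + 1) else 0)
        + ((if j.val = i.val + 1 then -f (i.val + 2) else 0)
        + (if j.val + 1 = i.val then -f i.val else 0)) := by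
    simp only [laplacian, Matrix.of_apply, Fin.ext_iff]
    rcases lt_trichotomy i.val j.val with h | h | h
    · by_cases h' : j.val = i.val + 1
      · simp [h']; intro; omega
      · rw [if_neg (by omega), if_neg (by omega), if_neg (by omega), if_neg h',
          if_neg (by omega)]; simp
    · simp [h]
    · by_cases h' : j.val + 1 = i.val
      · rw [if_neg (by omega), if_pos (by omega), if_neg (by omega), if_neg (by omega), if_pos h',
          h']; ring
      · rw [if_neg (by omega), if_neg (by omega), if_neg (by omega), if_neg (by omega),
          if_neg h']; simp
  have hsum (c : ℝ) (q : ℕ) (hq : n ≤ q → c = 0) :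
      ∑ j : Fin n, (if j.val = q then c else 0) = c := by
    rw [Fin.sum_univ_eq_sum_range (fun j => if j = q then c else 0) n, Finset.sum_ite_eq']
    split_ifs with h
    · rfl
    · exact (hq (by simpa using h)).symm
  have hlast : ∑ j : Fin n, (if j.val + 1 = i.val then -f i.val else 0) = -f i.val := by
    rcases Nat.eq_zero_or_pos i.val with h | h
    · simp [h, h0]
    · have e (j : Fin n) : (if j.val + 1 = i.val then -f i.val else 0) =
          if j.val = i.val - 1 then -f i.val else 0 := by
        congr 1; apply propext; omega
      simp only [e]
      exact hsum _ _ fun h' => by omega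
  simp only [Matrix.mulVec, dotProduct, hsplit, Finset.sum_add_distrib, hlast]
  rw [hsum _ _ fun h => by omega, hsum _ _ fun h => by
    have : i.val + 2 = n + 1 := by omega
    rw [this, hn, neg_zero]]
  ring

theorem isUnit_laplacian (n : ℕ) : IsUnit (laplacian n) := by
  rw [← Matrix.mulVec_injective_iff_isUnit]
  rw [← Matrix.coe_mulVecLin, ← LinearMap.ker_eq_bot, LinearMap.ker_eq_bot']
  intro x hx
  rw [Matrix.mulVecLin_apply] at hx
  set f : ℕ → ℝ := fun m => if h : 1 ≤ m ∧ m ≤ n then x ⟨m - 1, by omega⟩ else 0 with hf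
  have h0 : f 0 = 0 := by simp [hf]
  have hn : f (n + 1) = 0 := by simp [hf]
  have hxf : x = fun j => f (j.val + 1) := by
    funext j; simp [hf]
  have hrec (m : ℕ) (hm : m < n) : f (m + 2) = 2 * f (m + 1) - f m := by
    have := laplacian_mulVec n f h0 hn ⟨m, hm⟩
    rw [← hxf, hx] at this
    simp at this
    linarith
  -- a sequence with vanishing second differences is linear
  have hlin (m : ℕ) : m ≤ n + 1 → f m = m * f 1 := by
    induction m using Nat.twoStepInduction with
    | zero => simp [h0]
    | one => simp
    | more m ih ih' =>
      intro hm
      rw [hrec m (by omega), ih (by omega), ih' (by omega)]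
      push_cast; ring
  have h1 : f 1 = 0 := by
    have := hlin (n + 1) le_rfl
    rw [hn] at this
    have hne : ((n + 1 : ℕ) : ℝ) ≠ 0 := by positivity
    exact (mul_eq_zero.1 this.symm).resolve_left hne
  rw [hxf]
  funext j
  rw [hlin _ (by omega), h1]
  simp

/-- The row vector `𝟙ᵀ D⁻¹` is the discrete parabola `(k + 1)(n - k) / 2`. -/
theorem one_dotProduct_laplacian_inv_mulVec (n : ℕ) (x : Fin n → ℝ) :
    (fun _ => 1) ⬝ᵥ ((laplacian n)⁻¹ *ᵥ x) = ∑ k : Fin n, ((k : ℝ) + 1) * (n - k) / 2 * x k := by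
  set v : Fin n → ℝ := fun k => ((k : ℝ) + 1) * (n - k) / 2 with hv
  have hsymm : (laplacian n)ᵀ = laplacian n := by
    ext i j
    simp only [laplacian, Matrix.transpose_apply, Matrix.of_apply, eq_comm (a := j),
      or_comm (a := j.val + 1 = i.val)]
  have hD : laplacian n *ᵥ v = fun _ => 1 := by
    funext i
    have := laplacian_mulVec n (fun m => (m : ℝ) * (n + 1 - m) / 2) (by simp) (by simp) i
    have e : v = fun j : Fin n => ((j.val + 1 : ℕ) : ℝ) * (n + 1 - (j.val + 1 : ℕ)) / 2 := by
      funext j; simp only [hv]; push_cast; ring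
    rw [e, this]
    push_cast
    ring
  have hdet := (Matrix.isUnit_iff_isUnit_det _).1 (isUnit_laplacian n)
  have hv1 : (fun _ => (1 : ℝ)) ᵥ* (laplacian n)⁻¹ = v := by
    rw [← hD, ← Matrix.vecMul_transpose, hsymm, Matrix.vecMul_vecMul,
      Matrix.mul_nonsing_inv _ hdet, Matrix.vecMul_one]
  rw [Matrix.dotProduct_mulVec, hv1]
  rfl

theorem sum_laplacian_weight (n : ℕ) :
    ∑ k : Fin n, ((k : ℝ) + 1) * (n - k) / 2 = n * (n + 1) * (n + 2) / 12 := by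
  have h (m : ℕ) (y : ℝ) : ∑ k ∈ Finset.range m, ((k : ℝ) + 1) * (y - k) / 2 =
      y * (m * (m + 1)) / 4 - (m - 1) * m * (m + 1) / 6 := by
    induction m with
    | zero => simp
    | succ m ih => rw [Finset.sum_range_succ, ih]; push_cast; ring
  rw [Fin.sum_univ_eq_sum_range (fun k => ((k : ℝ) + 1) * (n - k) / 2) n, h]
  ring

/-- The Laplacian average of the increments of `F` is half the least-squares slope of `F`
as a function of its index. -/
theorem halfWeightedAverage_diff (n : ℕ) (F : Fin (n + 1) → ℝ) :
    halfWeightedAverage (fun k : Fin n => F k.succ - F k.castSucc) =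
      3 / (n * (n + 1) * (n + 2)) * ∑ k : Fin (n + 1), (2 * (k : ℝ) - n) * F k := by
  have h1 : ∑ k : Fin n, ((k : ℝ) + 1) * (n - k) / 2 * F k.succ =
      ∑ k : Fin (n + 1), (k : ℝ) * (n + 1 - k) / 2 * F k := by
    rw [Fin.sum_univ_succ]
    simp
  have h2 : ∑ k : Fin n, ((k : ℝ) + 1) * (n - k) / 2 * F k.castSucc =
      ∑ k : Fin (n + 1), ((k : ℝ) + 1) * (n - k) / 2 * F k := by
    rw [Fin.sum_univ_castSucc]
    simp
  have hs : ∑ k : Fin n, ((k : ℝ) + 1) * (n - k) / 2 * (F k.succ - F k.castSucc) =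
      1 / 2 * ∑ k : Fin (n + 1), (2 * (k : ℝ) - n) * F k := by
    rw [Finset.sum_congr rfl fun k _ => mul_sub _ _ _, Finset.sum_sub_distrib, h1, h2,
      ← Finset.sum_sub_distrib, Finset.mul_sum]
    exact Finset.sum_congr rfl fun k _ => by ring
  unfold halfWeightedAverage
  rw [one_dotProduct_laplacian_inv_mulVec, one_dotProduct_laplacian_inv_mulVec, hs]
  simp only [mul_one, sum_laplacian_weight]
  rw [div_div_eq_mul_div]
  ring

theorem thetaPd_eq {d M : ℕ} (s : PdRecord d M) :
    thetaPd s =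
      3 / (d * (d + 1) * (d + 2)) * ∑ k : Fin (d + 1), (2 * (k : ℝ) - d) * ‖hExp (s k)‖ :=
  halfWeightedAverage_diff d fun k => ‖hExp (s k)‖

/-! ### Power sums -/

theorem sum_sq_mul_cube (n : ℕ) (x : ℝ) :
    ∑ k ∈ Finset.range (n + 1), (k : ℝ) ^ 2 * (x + 2 * k) ^ 3 =
      x ^ 3 * (n * (n + 1) * (2 * n + 1) / 6) + 6 * x ^ 2 * (n ^ 2 * (n + 1) ^ 2 / 4)
        + 12 * x * (n * (n + 1) * (2 * n + 1) * (3 * n ^ 2 + 3 * n - 1) / 30)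
        + 8 * (n ^ 2 * (n + 1) ^ 2 * (2 * n ^ 2 + 2 * n - 1) / 12) := by
  induction n with
  | zero => simp
  | succ n ih => rw [Finset.sum_range_succ, ih]; push_cast; ring

theorem sum_sq (n : ℕ) :
    ∑ k ∈ Finset.range (n + 1), (k : ℝ) ^ 2 = n * (n + 1) * (2 * n + 1) / 6 := by
  induction n with
  | zero => simp
  | succ n ih => rw [Finset.sum_range_succ, ih]; push_cast; ring

theorem sum_range_reflected (n : ℕ) (f : ℝ → ℝ) :
    ∑ k ∈ Finset.range (n + 1), f (n - k) = ∑ k ∈ Finset.range (n + 1), f k := by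
  rw [← Finset.sum_range_reflect (fun k : ℕ => f k)]
  refine Finset.sum_congr rfl fun k hk => ?_
  have hk := Finset.mem_range.1 hk
  rw [Nat.add_sub_cancel, Nat.cast_sub (by omega)]

/-- The numbers `35` and `76` are such that, in the final estimate, this bound and the contribution
of the shot noise have a sum divisible by `d + 2`. -/
theorem sum_sq_mul_cube_le (d : ℕ) (hd : 2 ≤ d) :
    ∑ k ∈ Finset.range (d + 1), (k : ℝ) ^ 2 * (d + 2 * k) ^ 3 ≤
      (d : ℝ) ^ 4 * (d + 1) * (35 * d + 76) / 6 := by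
  rw [sum_sq_mul_cube]
  have h : (2 : ℝ) ≤ d := by exact_mod_cast hd
  generalize (d : ℝ) = x at *
  obtain ⟨y, rfl⟩ : ∃ y, x = y + 2 := ⟨x - 2, by ring⟩
  have hy : 0 ≤ y := by linarith
  rw [← sub_nonneg]
  ring_nf
  positivity

theorem sum_reflected_sq_mul_cube_le (d : ℕ) (hd : 2 ≤ d) :
    ∑ k ∈ Finset.range (d + 1), ((d : ℝ) - k) ^ 2 * (d + 2 * k) ^ 3 ≤
      (d : ℝ) ^ 4 * (d + 1) * (35 * d + 76) / 6 := by
  have e : ∑ k ∈ Finset.range (d + 1), ((d : ℝ) - k) ^ 2 * (d + 2 * k) ^ 3 =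
      -∑ k ∈ Finset.range (d + 1), (k : ℝ) ^ 2 * (-(3 * d) + 2 * k) ^ 3 := by
    rw [← sum_range_reflected d fun t => t ^ 2 * (-(3 * (d : ℝ)) + 2 * t) ^ 3,
      ← Finset.sum_neg_distrib]
    exact Finset.sum_congr rfl fun k _ => by ring
  -- `d + 2 (d - k) = -(-3 d + 2 k)`, so the closed form applies at `-3 d`
  rw [e, sum_sq_mul_cube]
  have h : (2 : ℝ) ≤ d := by exact_mod_cast hd
  generalize (d : ℝ) = x at *
  obtain ⟨y, rfl⟩ : ∃ y, x = y + 2 := ⟨x - 2, by ring⟩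
  have hy : 0 ≤ y := by linarith
  rw [← sub_nonneg]
  ring_nf
  positivity

/-- The regression slope of amplitudes lying within `[-c(d+2k)³, N]` of the line `k ↦ (d+2k)θ`. -/
theorem abs_slope_sub_le (d : ℕ) (hd : 2 ≤ d) (E : ℕ → ℝ) (θ c N : ℝ) (hc : 0 ≤ c)
    (hlow : ∀ k, (d + 2 * k) * θ - c * (d + 2 * k) ^ 3 ≤ E k)
    (hup : ∀ k, E k ≤ (d + 2 * k) * θ + N) :
    |3 / (d * (d + 1) * (d + 2)) * ∑ k ∈ Finset.range (d + 1), (2 * (k : ℝ) - d) * E k - θ| ≤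
      N * (2 * d + 1) / (2 * d * (d + 2)) + c * (d ^ 2 * (35 * d + 76)) / (2 * (d + 2)) := by
  have hd0 : (0 : ℝ) < d := by exact_mod_cast (by omega : 0 < d)
  set e : ℕ → ℝ := fun k => E k - (d + 2 * k) * θ with he
  have hlin : ∑ k ∈ Finset.range (d + 1), (2 * (k : ℝ) - d) * (d + 2 * k) =
      d * (d + 1) * (d + 2) / 3 := by
    have h (n : ℕ) : ∑ k ∈ Finset.range (n + 1), (2 * (k : ℝ) - d) * (d + 2 * k) =
        4 * (n * (n + 1) * (2 * n + 1) / 6) - d ^ 2 * (n + 1) := by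
      induction n with
      | zero => simp; ring
      | succ n ih => rw [Finset.sum_range_succ, ih]; push_cast; ring
    rw [h]; ring
  -- the weights are differences of two nonnegative ones: `2k - d = (k² - (d - k)²) / d`
  have hsplit : ∑ k ∈ Finset.range (d + 1), (2 * (k : ℝ) - d) * E k =
      d * (d + 1) * (d + 2) / 3 * θ + 1 / d *
        (∑ k ∈ Finset.range (d + 1), (k : ℝ) ^ 2 * e k -
          ∑ k ∈ Finset.range (d + 1), ((d : ℝ) - k) ^ 2 * e k) := by
    rw [← hlin, Finset.sum_mul, ← Finset.sum_sub_distrib, Finset.mul_sum, ← Finset.sum_add_distrib]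
    refine Finset.sum_congr rfl fun k _ => ?_
    simp only [he]
    field_simp
    ring
  have hP := sum_sq_mul_cube_le d hd
  have hQ := sum_reflected_sq_mul_cube_le d hd
  have hS := sum_sq d
  have hS' : ∑ k ∈ Finset.range (d + 1), ((d : ℝ) - k) ^ 2 = d * (d + 1) * (2 * d + 1) / 6 := by
    rw [sum_range_reflected d fun t => t ^ 2, hS]
  have bound (w : ℕ → ℝ) (hw : ∀ k, 0 ≤ w k)
      (h1 : ∑ k ∈ Finset.range (d + 1), w k = d * (d + 1) * (2 * d + 1) / 6)
      (h2 : ∑ k ∈ Finset.range (d + 1), w k * (d + 2 * k) ^ 3 ≤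
        (d : ℝ) ^ 4 * (d + 1) * (35 * d + 76) / 6) :
      ∑ k ∈ Finset.range (d + 1), w k * e k ≤ N * (d * (d + 1) * (2 * d + 1) / 6) ∧
      -(c * ((d : ℝ) ^ 4 * (d + 1) * (35 * d + 76) / 6)) ≤
        ∑ k ∈ Finset.range (d + 1), w k * e k := by
    constructor
    · rw [← h1, Finset.mul_sum]
      refine Finset.sum_le_sum fun k _ => ?_
      rw [mul_comm N]
      exact mul_le_mul_of_nonneg_left (by simp only [he]; linarith [hup k]) (hw k)
    · refine (neg_le_neg (mul_le_mul_of_nonneg_left h2 hc)).trans ?_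
      rw [Finset.mul_sum, ← Finset.sum_neg_distrib]
      refine Finset.sum_le_sum fun k _ => ?_
      have := mul_le_mul_of_nonneg_left (show -(c * (d + 2 * k) ^ 3) ≤ e k by
        simp only [he]; linarith [hlow k]) (hw k)
      linarith
  obtain ⟨u1, l1⟩ := bound (fun k => (k : ℝ) ^ 2) (fun k => sq_nonneg _) hS hP
  obtain ⟨u2, l2⟩ := bound (fun k => ((d : ℝ) - k) ^ 2) (fun k => sq_nonneg _) hS' hQ
  rw [hsplit]
  set X := ∑ k ∈ Finset.range (d + 1), (k : ℝ) ^ 2 * e k -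
    ∑ k ∈ Finset.range (d + 1), ((d : ℝ) - k) ^ 2 * e k with hX
  have hXle : |X| ≤ N * (d * (d + 1) * (2 * d + 1) / 6) +
      c * ((d : ℝ) ^ 4 * (d + 1) * (35 * d + 76) / 6) := by
    rw [abs_le]; constructor <;> linarith
  have e1 : 3 / ((d : ℝ) * (d + 1) * (d + 2)) * (d * (d + 1) * (d + 2) / 3 * θ + 1 / d * X) - θ
      = 3 / ((d : ℝ) ^ 2 * (d + 1) * (d + 2)) * X := by
    field_simp; ring
  rw [e1, abs_mul, abs_of_pos (by positivity)]
  refine (mul_le_mul_of_nonneg_left hXle (by positivity)).trans (le_of_eq ?_)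
  field_simp
  ring

/-! ### The bias of the progressive difference estimator -/

/-- The conditional bias given the prior angle `ω`. -/
theorem abs_integral_thetaPd_sub_le {d M : ℕ} (hd : 2 ≤ d) (hM : 1 ≤ M) (ω θ φ χ : ℝ)
    (hθ : 0 < θ) (hθ1 : θ ≤ 1) :
    |∫ s, thetaPd s ∂(pdLaw d M ω θ φ χ) - θ| ≤
      1 / (4 * M * (d * θ)) * (2 * d + 1) / (2 * d * (d + 2)) +
        (θ * (ω - φ) ^ 2 / 6 + 7 / 6 * θ ^ 3) * (d ^ 2 * (35 * d + 76)) / (2 * (d + 2)) := by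
  have hd0 : (0 : ℝ) < d := by exact_mod_cast (by omega : 0 < d)
  have hM0 : (0 : ℝ) < M := by exact_mod_cast hM
  have hint : ∫ s, thetaPd s ∂(pdLaw d M ω θ φ χ) =
      3 / (d * (d + 1) * (d + 2)) * ∑ k ∈ Finset.range (d + 1),
        (2 * (k : ℝ) - d) * ∫ s, ‖hExp s‖ ∂(shotsLaw (d + 2 * k) M ω θ φ χ) := by
    simp only [thetaPd_eq]
    rw [integral_const_mul, integral_finsetSum _ fun _ _ => .of_finite,
      ← Fin.sum_univ_eq_sum_range
        (fun k => (2 * (k : ℝ) - d) * ∫ s, ‖hExp s‖ ∂(shotsLaw (d + 2 * k) M ω θ φ χ)) (d + 1)]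
    congr 1
    refine Finset.sum_congr rfl fun k _ => ?_
    rw [integral_const_mul]
    congr 1
    exact integral_comp_eval (μ := fun k : Fin (d + 1) => shotsLaw (d + 2 * k.val) M ω θ φ χ)
      (i := k) (f := fun s => ‖hExp s‖) .of_discrete
  rw [hint]
  refine abs_slope_sub_le d hd _ θ _ _ (by positivity) (fun k => ?_) fun k => ?_
  · have := (integral_norm_hExp_bounds hM (d + 2 * k) (by omega) ω θ φ χ hθ hθ1).1
    push_cast at this
    exact this
  · have := (integral_norm_hExp_bounds hM (d + 2 * k) (by omega) ω θ φ χ hθ hθ1).2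
    push_cast at this
    refine this.trans ?_
    have hk : (0 : ℝ) ≤ k := Nat.cast_nonneg k
    gcongr
    linarith

/-- Bias-variance decomposition of the mean squared error of the prior. -/
theorem integral_phiHat_sub_sq {d M : ℕ} (θ φ χ : ℝ) :
    ∫ r, (phiHat r - φ) ^ 2 ∂(priorLaw d M θ φ χ) =
      variance (phiHat (d := d) (M := M)) (priorLaw d M θ φ χ) + biasPhi d M θ φ χ ^ 2 := by
  have hs := variance_eq_sub (μ := priorLaw d M θ φ χ) (X := fun r => phiHat r - φ) .of_discrete
  rw [variance_sub_const .of_discrete, integral_sub .of_finite .of_finite] at hs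
  simp only [Pi.pow_apply, integral_const, probReal_univ, one_smul] at hs
  unfold biasPhi
  linarith

end QSPC
end

theorem mainTheorem9 (d M : ℕ) (hd : 2 ≤ d) (hM : 1 ≤ M) (θ φ χ : ℝ) (hθ : 0 < θ)
    (hdθ : (d : ℝ) * θ ≤ 1 / 9)
    (hφ : ProbabilityTheory.variance (QSPC.phiHat (d := d) (M := M)) (QSPC.priorLaw d M θ φ χ) +
        QSPC.biasPhi d M θ φ χ ^ 2 ≤ 2 * (3 / (8 * (d : ℝ) ^ 4 * θ ^ 2 * (M : ℝ)))) :
    |QSPC.biasPd d M θ φ χ| ≤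
      39 / (16 * (d : ℝ) ^ 2 * (M : ℝ) * θ) + 7 * (d : ℝ) * θ / (M : ℝ) +
        19 * ((d : ℝ) * θ) ^ 3 := by
  have hd2 : (2 : ℝ) ≤ d := by exact_mod_cast hd
  have hd0 : (0 : ℝ) < d := by linarith
  have hM0 : (0 : ℝ) < M := by exact_mod_cast hM
  have hθ1 : θ ≤ 1 := by nlinarith
  rw [← QSPC.integral_phiHat_sub_sq] at hφ
  set μ := QSPC.priorLaw d M θ φ χ with hμ
  have hbias : QSPC.biasPd d M θ φ χ =
      ∫ r, (∫ s, QSPC.thetaPd s ∂(QSPC.pdLaw d M (QSPC.phiHat r) θ φ χ) - θ) ∂μ := by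
    unfold QSPC.biasPd QSPC.experimentLaw
    rw [Measure.integral_compProd .of_finite, integral_sub .of_finite .of_finite]
    simp only [integral_const, probReal_univ, one_smul]
    rfl
  have hC : |QSPC.biasPd d M θ φ χ| ≤
      1 / (4 * M * (d * θ)) * (2 * d + 1) / (2 * d * (d + 2)) +
        (θ * (∫ r, (QSPC.phiHat r - φ) ^ 2 ∂μ) / 6 + 7 / 6 * θ ^ 3) *
          (d ^ 2 * (35 * d + 76)) / (2 * (d + 2)) := by
    rw [hbias]
    refine (abs_integral_le_integral_abs).trans ?_
    refine (integral_mono .of_finite .of_finite fun r =>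
      QSPC.abs_integral_thetaPd_sub_le hd hM (QSPC.phiHat r) θ φ χ hθ hθ1).trans (le_of_eq ?_)
    rw [integral_add .of_finite .of_finite, integral_const, integral_div, integral_mul_const,
      integral_add .of_finite .of_finite, integral_div, integral_const_mul]
    simp
  have hcube : 7 / 6 * θ ^ 3 * ((d : ℝ) ^ 2 * (35 * d + 76)) / (2 * (d + 2)) ≤
      19 * ((d : ℝ) * θ) ^ 3 := by
    rw [div_le_iff₀ (by positivity)]
    have : 0 ≤ θ ^ 3 * (d : ℝ) ^ 2 := by positivity
    nlinarith [mul_nonneg this (by nlinarith : (0 : ℝ) ≤ 228 * d * (d + 2) - 7 * (35 * d + 76))]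
  have hpos : 0 ≤ 7 * (d : ℝ) * θ / M := by positivity
  -- the shot noise and the phase mismatch add up to exactly `39 / (16 d² M θ)`
  have hmain : 1 / (4 * M * (d * θ)) * (2 * d + 1) / (2 * d * (d + 2)) +
      (θ * (2 * (3 / (8 * (d : ℝ) ^ 4 * θ ^ 2 * (M : ℝ)))) / 6) *
        (d ^ 2 * (35 * d + 76)) / (2 * (d + 2)) = 39 / (16 * (d : ℝ) ^ 2 * (M : ℝ) * θ) := by
    field_simp
    ring
  have hmono : (θ * (∫ r, (QSPC.phiHat r - φ) ^ 2 ∂μ) / 6) *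
        ((d : ℝ) ^ 2 * (35 * d + 76)) / (2 * (d + 2)) ≤
      (θ * (2 * (3 / (8 * (d : ℝ) ^ 4 * θ ^ 2 * (M : ℝ)))) / 6) *
        (d ^ 2 * (35 * d + 76)) / (2 * (d + 2)) := by
    gcongr
  rw [add_mul, add_div] at hC
  linarith
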